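/- Let $A$ be a finite alphabet, and let $A^*$ be the free monoid of words over $A$, with empty word $\varepsilon$. For $u,v\in A^*$ let $\binom{u}{v}_q\in\mathbb{N}[q]$ be the $q$-binomial coefficient of words, defined recursively, for all words $u,v\in A^*$ and letters $a,b\in A$, by \[ \binom{u}{\varepsilon}_q=1,\qquad \binom{\varepsilon}{v}_q=0\ \text{ if } v\neq\varepsilon,\qquad \binom{ua}{vb}_q=q^{|vb|}\binom{u}{vb}_q+\delta_{a,b}\binom{u}{v}_q , \] where $|w|$ is the length of the word $w$ and $\delta_{a,b}$ is the Kronecker delta. Let $p$ be a prime. A language $L\subseteq A^*$ is a $p$-group language if there exist a finite $p$-group $G$, a monoid morphism $\mu:A^*\to G$ and a subset $S\subseteq G$ such that $L=\mu^{-1}(S)$. For $v\in A^*$ and polynomials $\mathfrak{R},\mathfrak{M}\in\mathbb{F}_p[q]$ with $\deg\mathfrak{R}<\deg\mathfrak{M}$ (where $\deg 0=-\infty$), let \[ L_{v,\mathfrak{R},\mathfrak{M}}=\left\{u\in A^*\ \middle|\ \binom{u}{v}_q\equiv\mathfrak{R}\pmod{\mathfrak{M}}\right\}, \] where the coefficients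 of $\binom{u}{v}_q$ are reduced modulo $p$. \textbf{Theorem.} Let $p$ be a prime and let $\mathfrak{M}=a(q-1)^d$ with $d\ge 1$ an integer and $a\in\mathbb{F}_p$ non-zero. A language $L\subseteq A^*$ is a $p$-group language if and only if it is a Boolean combination (by finite unions, finite intersections and complements in $A^*$) of languages of the form $L_{v,\mathfrak{R},\mathfrak{M}}$ with $v\in A^*$, $\mathfrak{R}\in\mathbb{F}_p[q]$ and $\deg\mathfrak{R}<\deg\mathfrak{M}$. -/

import Mathlib

open Polynomial

/-- Auxiliary recursion on reversed words: the head of each list is the last letter of the word. -/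
noncomputable def qBinomialRev {A : Type*} [DecidableEq A] : List A → List A → ℕ[X]
  | _, [] => 1
  | [], _ :: _ => 0
  | a :: u, b :: v =>
      qBinomialRev u (b :: v) * X ^ (b :: v).length + if a = b then qBinomialRev u v else 0

/-- The `q`-deformed binomial coefficient of the words `u` and `v`, a polynomial with
coefficients in `ℕ`. The three theorems that follow are its defining recursion. -/
noncomputable def qBinomial {A : Type*} [DecidableEq A] (u v : List A) : ℕ[X] :=
  qBinomialRev u.reverse v.reverse

theorem qBinomial_nil_right {A : Type*} [DecidableEq A] (u : List A) :
    qBinomial u [] = 1 := by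
  unfold qBinomial
  rw [List.reverse_nil, qBinomialRev]

theorem qBinomial_nil_left {A : Type*} [DecidableEq A] {v : List A} (hv : v ≠ []) :
    qBinomial [] v = 0 := by
  unfold qBinomial
  rcases h : v.reverse with _ | ⟨b, w⟩
  · exact absurd (List.reverse_eq_nil_iff.mp h) hv
  · rw [List.reverse_nil, qBinomialRev]

theorem qBinomial_concat_concat {A : Type*} [DecidableEq A] (u v : List A) (a b : A) :
    qBinomial (u ++ [a]) (v ++ [b]) =
      qBinomial u (v ++ [b]) * X ^ (v ++ [b]).length + if a = b then qBinomial u v else 0 := by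
  simp [qBinomial, qBinomialRev]

/-- The language `L_{v,R,M}` of all words `u` such that the `q`-binomial of `u` and `v`, with
coefficients reduced modulo `p`, is congruent to `R` modulo `M`. -/
def qBinomialLanguage {A : Type*} [DecidableEq A] {p : ℕ} (v : List A) (R M : (ZMod p)[X]) :
    Language A :=
  {u : List A | M ∣ (qBinomial u v).map (Nat.castRingHom (ZMod p)) - R}

/-- The monoid `N` recognizes the language `L`: there is a monoid morphism from the free monoid
to `N` for which `L` is the preimage of a subset of `N`. -/
def MonoidRecognizes {A : Type*} (N : Type*) [Monoid N] (L : Language A) : Prop :=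
  ∃ (μ : FreeMonoid A →* N) (S : Set N), ∀ w : List A, w ∈ L ↔ μ (FreeMonoid.ofList w) ∈ S

/-- `L` is a `p`-group language: it is recognized by some finite `p`-group. (Up to isomorphism,
every finite group lives in `Type`.) -/
def IsPGroupLanguage {A : Type*} (p : ℕ) (L : Language A) : Prop :=
  ∃ (G : Type) (_ : Group G), Finite G ∧ IsPGroup p G ∧ MonoidRecognizes G L

/-! Both directions rest on unipotence in characteristic $p$. Modulo $(q-1)^d$, the $q$-binomials of
$u$ against the prefixes of $v$ form a vector over a finite ring, and appending a letter to $u$ acts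
on it linearly. These maps are unipotent for one filtration, which mixes prefix length with powers
of $q-1$ (`qBinomialStep_mem`), so they generate a finite $p$-group
(`isPGroupLanguage_of_unipotent`). Closure of $p$-group languages under Boolean operations does the
rest. Conversely, given $\mu:A^*\to G$, put $x_a=\mu(a)-1$ in $\mathbb{F}_p[G]$. Products of $n$
such elements vanish for some $n$ (`exists_prod_of_sub_one_smul_eq_zero`), so expanding
$\prod(1+x_a)$ gives $\mu(u)=\sum_{|v|<n}\binom{u}{v}x_v$ with ordinary binomials mod $p$
(`prod_eq_sum_magnusPart`). These are values at $q=1$, determined by the residues mod $\mathfrak{M}$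
because $\mathfrak{M}(1)=0$. Finitely many pairs $(v,\mathfrak{R})$ therefore decide membership in
$L$. -/

/-! ### Unipotent monoids and closure properties of $p$-group languages -/

section Recognition

/-- In characteristic $p$, $x^{p^n}-1=(x-1)^{p^n}$, so unipotent elements have $p$-power order; in
particular they are invertible inside `S`. -/
theorem isPGroupLanguage_of_unipotent {A : Type*} {p : ℕ} [Fact p.Prime] {E : Type} [Ring E]
    [Finite E] [CharP E p] (S : Submonoid E) (hS : ∀ x ∈ S, IsNilpotent (x - 1))
    (f : A → S) (T : Set S) :
    IsPGroupLanguage p ({w : List A | FreeMonoid.lift f (FreeMonoid.ofList w) ∈ T} : Language A) := by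
  have hpow : ∀ x : S, ∃ k : ℕ, x ^ p ^ k = 1 := by
    rintro ⟨x, hx⟩
    obtain ⟨n, hn⟩ := hS x hx
    -- The nilpotency exponent also serves as the Frobenius exponent, since $n\le p^n$.
    refine ⟨n, Subtype.ext ?_⟩
    have hle : n ≤ p ^ n := (Nat.lt_pow_self (Fact.out : p.Prime).one_lt).le
    have h := add_pow_char_pow_of_commute (R := E) (x := x - 1) (y := 1) p n
      (Commute.one_right _)
    rw [sub_add_cancel, pow_eq_zero_of_le hle hn, one_pow, zero_add] at h
    simpa using h
  have hunit : ∀ x : S, IsUnit x := fun x => by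
    obtain ⟨k, hk⟩ := hpow x
    exact IsUnit.of_pow_eq_one hk (pow_pos (Fact.out : p.Prime).pos k).ne'
  refine ⟨S, groupOfIsUnit hunit, inferInstance, fun x => ?_, FreeMonoid.lift f, T, fun w => Iff.rfl⟩
  exact hpow x

variable {A : Type*} {p : ℕ}

theorem isPGroupLanguage_bot : IsPGroupLanguage p (⊥ : Language A) :=
  ⟨Unit, inferInstance, inferInstance, fun _ => ⟨0, Subsingleton.elim _ _⟩, 1, ∅,
    fun _ => Iff.rfl⟩

theorem IsPGroupLanguage.compl {L : Language A} (h : IsPGroupLanguage p L) :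
    IsPGroupLanguage p Lᶜ := by
  obtain ⟨G, hG, hfin, hp, μ, S, hS⟩ := h
  exact ⟨G, hG, hfin, hp, μ, Sᶜ, fun w => not_congr (hS w)⟩

theorem IsPGroupLanguage.sup {L K : Language A} (hL : IsPGroupLanguage p L)
    (hK : IsPGroupLanguage p K) : IsPGroupLanguage p (L ⊔ K) := by
  obtain ⟨G, hG, hfin, hp, μ, S, hS⟩ := hL
  obtain ⟨H, hH, hfin', hp', ν, T, hT⟩ := hK
  refine ⟨G × H, inferInstance, inferInstance, ?_, μ.prod ν, {x | x.1 ∈ S ∨ x.2 ∈ T},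
    fun w => or_congr (hS w) (hT w)⟩
  rintro ⟨g, h⟩
  obtain ⟨k, hk⟩ := hp g
  obtain ⟨l, hl⟩ := hp' h
  refine ⟨k + l, Prod.ext ?_ ?_⟩
  · simp [pow_add, pow_mul, hk]
  · simp [pow_add, mul_comm (p ^ k), pow_mul, hl]

/-- The endomorphisms that induce the identity on the successive quotients of a filtration. -/
def unipotentSubmonoid {K V : Type*} [CommRing K] [AddCommGroup V] [Module K V]
    (F : ℕ → Submodule K V) (hF : Antitone F) : Submonoid (Module.End K V) where
  carrier := {T | ∀ i, ∀ x ∈ F i, (T - 1) x ∈ F (i + 1)}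
  one_mem' := fun i x _ => by simp
  mul_mem' := fun {T U} hT hU i x hx => by
    have h : (T * U - 1) x = (T - 1) ((U - 1) x) + (U - 1) x + (T - 1) x := by
      simp only [LinearMap.sub_apply, Module.End.mul_apply, Module.End.one_apply, map_sub]
      abel
    rw [h]
    exact add_mem (add_mem (hF (Nat.le_succ _) (hT _ _ (hU i x hx))) (hU i x hx)) (hT i x hx)

theorem isNilpotent_sub_one_of_mem_unipotentSubmonoid {K V : Type*} [CommRing K] [AddCommGroup V]
    [Module K V] {F : ℕ → Submodule K V} (hF : Antitone F) (h0 : F 0 = ⊤) {n : ℕ} (hn : F n = ⊥)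
    {T : Module.End K V} (hT : T ∈ unipotentSubmonoid F hF) : IsNilpotent (T - 1) := by
  have key : ∀ i x, ((T - 1) ^ i) x ∈ F i := by
    intro i
    induction i with
    | zero => intro x; rw [h0]; trivial
    | succ i ih =>
      intro x
      rw [pow_succ', Module.End.mul_apply]
      exact hT i _ (ih x)
  refine ⟨n, LinearMap.ext fun x => ?_⟩
  simpa [hn] using key n x

end Recognition

/-! ### The linear automaton computing $q$-binomials -/

section BinomialAutomaton

variable {A : Type*} [DecidableEq A] {K R : Type*} [CommRing K] [CommRing R] [Algebra K R]

/-- The action of appending the letter `a` on the vector of `q`-binomial coefficients of the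
prefixes of the word `v`. -/
def qBinomialStep (K : Type*) [CommRing K] [Algebra K R] (q : R) {n : ℕ} (v : Fin n → A) (a : A) :
    Module.End K (Fin (n + 1) → R) where
  toFun x := Fin.cases (x 0) fun k =>
    q ^ (k.1 + 1) * x k.succ + if a = v k then x k.castSucc else 0
  map_add' x y := by
    ext j
    cases j using Fin.cases with
    | zero => simp
    | succ k => by_cases h : a = v k <;> simp [h] <;> ring
  map_smul' c x := by
    ext j
    cases j using Fin.cases with
    | zero => simp
    | succ k => by_cases h : a = v k <;> simp [h]

theorem qBinomialStep_zero (q : R) {n : ℕ} (v : Fin n → A) (a : A) (x : Fin (n + 1) → R) :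
    qBinomialStep K q v a x 0 = x 0 := rfl

theorem qBinomialStep_succ (q : R) {n : ℕ} (v : Fin n → A) (a : A) (x : Fin (n + 1) → R)
    (k : Fin n) : qBinomialStep K q v a x k.succ =
      q ^ (k.1 + 1) * x k.succ + if a = v k then x k.castSucc else 0 := rfl

/-- The vectors whose `j`-th coordinate is divisible by `y ^ (i - j)`. -/
def weightFiltration (K : Type*) [CommRing K] [Algebra K R] (y : R) (n i : ℕ) :
    Submodule K (Fin (n + 1) → R) where
  carrier := {x | ∀ j : Fin (n + 1), y ^ (i - j.1) ∣ x j}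
  zero_mem' := fun _ => dvd_zero _
  add_mem' := fun hx hz j => dvd_add (hx j) (hz j)
  smul_mem' := fun c x hx j => by
    rw [Pi.smul_apply, Algebra.smul_def]
    exact (hx j).mul_left _

theorem antitone_weightFiltration (y : R) (n : ℕ) : Antitone (weightFiltration K y n) :=
  fun _ _ h _ hx j => (pow_dvd_pow y (Nat.sub_le_sub_right h _)).trans (hx j)

theorem weightFiltration_zero (y : R) (n : ℕ) : weightFiltration K y n 0 = ⊤ :=
  eq_top_iff.mpr fun x _ j => by simp

theorem weightFiltration_eq_bot {y : R} {d : ℕ} (hy : y ^ d = 0) (n : ℕ) :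
    weightFiltration K y n (n + d) = ⊥ := by
  refine eq_bot_iff.mpr fun x hx => ?_
  ext j
  have h := hx j
  rw [pow_eq_zero_of_le (by omega) hy] at h
  exact zero_dvd_iff.mp h

/-- On coordinate $k+1$, the step minus the identity multiplies by $q^{k+1}-1$, which gains a factor
$q-1$, and may add coordinate $k$, which is already required to be divisible by one more power. -/
theorem qBinomialStep_mem (q : R) {n : ℕ} (v : Fin n → A) (a : A) :
    qBinomialStep K q v a ∈
      unipotentSubmonoid _ (antitone_weightFiltration (K := K) (q - 1) n) := by
  intro i x hx j
  cases j using Fin.cases with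
  | zero => simp [qBinomialStep_zero]
  | succ k =>
    have h : (qBinomialStep K q v a - 1) x k.succ =
        (q ^ (k.1 + 1) - 1) * x k.succ + if a = v k then x k.castSucc else 0 := by
      rw [LinearMap.sub_apply, Pi.sub_apply, qBinomialStep_succ, Module.End.one_apply]
      ring
    rw [h]
    refine dvd_add ?_ ?_
    -- Only an inequality of exponents: truncated subtraction breaks equality when $i\le k$.
    · refine (pow_dvd_pow _ (?_ : _ ≤ 1 + (i - k.succ.1))).trans ?_
      · omega
      · rw [pow_add, pow_one]
        exact mul_dvd_mul (sub_one_dvd_pow_sub_one q _) (hx _)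
    · split_ifs
      · refine (pow_dvd_pow _ (?_ : _ ≤ i - k.castSucc.1)).trans (hx _)
        simp
      · exact dvd_zero _

theorem map_qBinomial_concat (φ : ℕ[X] →+* R) {n : ℕ} (v : Fin n → A) (u : List A) (a : A) :
    (fun j : Fin (n + 1) => φ (qBinomial (u ++ [a]) ((List.ofFn v).take j.1))) =
      qBinomialStep K (φ X) v a
        (fun j : Fin (n + 1) => φ (qBinomial u ((List.ofFn v).take j.1))) := by
  ext j
  cases j using Fin.cases with
  | zero => simp [qBinomialStep_zero, qBinomial_nil_right]
  | succ k =>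
    have hk : (List.ofFn v).take (k.1 + 1) = (List.ofFn v).take k.1 ++ [v k] := by
      rw [List.take_succ_eq_append_getElem (by simp)]
      simp
    rw [qBinomialStep_succ]
    simp only [Fin.val_succ, Fin.val_castSucc, hk, qBinomial_concat_concat]
    have hlen : ((List.ofFn v).take k.1 ++ [v k]).length = k.1 + 1 := by simp
    rw [hlen]
    split_ifs <;> simp [mul_comm]

end BinomialAutomaton

theorem isPGroupLanguage_qBinomialLanguage {A : Type*} [DecidableEq A] (p : ℕ) [Fact p.Prime]
    (d : ℕ) (hd : 1 ≤ d) (a : ZMod p) (ha : a ≠ 0) (v : List A) (r : (ZMod p)[X]) :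
    IsPGroupLanguage p (qBinomialLanguage v r (C a * (X - 1) ^ d)) := by
  set M : (ZMod p)[X] := C a * (X - 1) ^ d with hM
  have hunit : IsUnit (C a : (ZMod p)[X]) := isUnit_C.mpr (isUnit_iff_ne_zero.mpr ha)
  have hX : ((X : (ZMod p)[X]) - 1) ^ d = (X - C 1) ^ d := by simp
  have hmonic : ((X : (ZMod p)[X]) - 1) ^ d |>.Monic := by
    rw [hX]; exact (monic_X_sub_C 1).pow d
  have hass : ∀ f : (ZMod p)[X], M ∣ f ↔ (X - 1) ^ d ∣ f := fun f => by
    rw [hM]; exact hunit.mul_left_dvd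
  let R := AdjoinRoot (((X : (ZMod p)[X]) - 1) ^ d)
  have hfin : Finite R := by
    have : Module.Finite (ZMod p) R := hmonic.finite_adjoinRoot
    exact Module.finite_of_finite (ZMod p)
  have hnt : Nontrivial R := by
    refine AdjoinRoot.nontrivial _ ?_
    rw [hX, degree_pow, degree_X_sub_C]
    simp; omega
  let φ : ℕ[X] →+* R := (AdjoinRoot.mk _).comp (mapRingHom (Nat.castRingHom (ZMod p)))
  have hq : (φ X - 1) ^ d = 0 := by
    have : φ X - 1 = AdjoinRoot.mk _ (X - 1) := by simp [φ]
    rw [this, ← map_pow, AdjoinRoot.mk_self]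
  obtain ⟨n, w, rfl⟩ : ∃ (n : ℕ) (w : Fin n → A), v = List.ofFn w :=
    ⟨v.length, v.get, (List.ofFn_get v).symm⟩
  let E := Module.End (ZMod p) (Fin (n + 1) → R)
  have hE : CharP E p := by
    have : Nontrivial E := inferInstance
    exact charP_of_injective_algebraMap (algebraMap (ZMod p) E).injective p
  have hE' : CharP Eᵐᵒᵖ p := inferInstance
  have hEfin : Finite E := Finite.of_injective _ (DFunLike.coe_injective (F := E))
  have hEfin' : Finite Eᵐᵒᵖ := Finite.of_equiv E MulOpposite.opEquiv
  let S := unipotentSubmonoid _ (antitone_weightFiltration (K := ZMod p) (φ X - 1) n)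
  -- Endomorphisms compose right to left, but the first letter must act first; hence the opposite
  -- monoid.
  let f : A → S.op := fun b => ⟨MulOpposite.op (qBinomialStep (ZMod p) (φ X) w b),
    qBinomialStep_mem (φ X) w b⟩
  let x₀ : Fin (n + 1) → R := fun j => φ (qBinomial [] ((List.ofFn w).take j.1))
  have key : ∀ u : List A, (fun j : Fin (n + 1) => φ (qBinomial u ((List.ofFn w).take j.1))) =
      (FreeMonoid.lift f (FreeMonoid.ofList u) : Eᵐᵒᵖ).unop x₀ := by
    intro u
    induction u using List.reverseRecOn with
    | nil => rfl
    | append_singleton u b ih =>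
      rw [map_qBinomial_concat (K := ZMod p), ih, FreeMonoid.ofList_append, map_mul,
        FreeMonoid.ofList_singleton, FreeMonoid.lift_eval_of]
      rfl
  have hlang : qBinomialLanguage (List.ofFn w) r M =
      {u : List A | FreeMonoid.lift f (FreeMonoid.ofList u) ∈
        {T : S.op | (T : Eᵐᵒᵖ).unop x₀ (Fin.last n) = AdjoinRoot.mk _ r}} := by
    ext u
    change M ∣ _ ↔ (FreeMonoid.lift f (FreeMonoid.ofList u) : Eᵐᵒᵖ).unop x₀ (Fin.last n) = _
    rw [← key u, hass]
    have hlen : (List.ofFn w).take (Fin.last n).1 = List.ofFn w := List.take_of_length_le (by simp)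
    beta_reduce
    rw [hlen]
    exact AdjoinRoot.mk_eq_mk.symm
  rw [hlang]
  exact isPGroupLanguage_of_unipotent (p := p) S.op
    (fun x hx => by
      obtain ⟨k, hk⟩ := isNilpotent_sub_one_of_mem_unipotentSubmonoid
        (antitone_weightFiltration (K := ZMod p) (φ X - 1) n)
        (weightFiltration_zero _ _) (weightFiltration_eq_bot hq n) hx
      exact ⟨k, MulOpposite.unop_injective (by simpa using hk)⟩)
    f _

/-! ### Nilpotence of the augmentation ideal -/

/-- The augmentation ideal of the group algebra of a `p`-group acts nilpotently on every finite
module. -/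
theorem exists_prod_of_sub_one_smul_eq_zero {p : ℕ} [Fact p.Prime] {G : Type*} [Group G]
    (hG : IsPGroup p G) (Q : Type*) [AddCommGroup Q] [Module (MonoidAlgebra (ZMod p) G) Q]
    [Finite Q] : ∃ n : ℕ, ∀ l : List G, l.length = n → ∀ x : Q,
      (l.map fun g => MonoidAlgebra.of (ZMod p) G g - 1).prod • x = 0 := by
  induction hc : Nat.card Q using Nat.strong_induction_on generalizing Q with
  | _ c ih =>
    rcases subsingleton_or_nontrivial Q with hQ | hQ
    · exact ⟨0, fun _ _ _ => Subsingleton.elim _ _⟩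
    -- The number of fixed points is congruent to $|Q|\equiv 0$ mod $p$, so besides $0$ there is a
    -- nonzero fixed vector. Its span is killed by every $g-1$, and the quotient by it is smaller.
    let _ : MulAction G Q := MulAction.compHom Q (MonoidAlgebra.of (ZMod p) G)
    have hp : p ∣ Nat.card Q := by
      obtain ⟨x, hx⟩ := exists_ne (0 : Q)
      have hpx : p • x = 0 := by
        have : ((p : MonoidAlgebra (ZMod p) G)) = 0 := by
          rw [← map_natCast (algebraMap (ZMod p) (MonoidAlgebra (ZMod p) G)), CharP.cast_eq_zero,
            map_zero]
        rw [← Nat.cast_smul_eq_nsmul (MonoidAlgebra (ZMod p) G), this, zero_smul]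
      rw [← addOrderOf_eq_prime hpx hx]
      exact addOrderOf_dvd_natCard x
    obtain ⟨x, hx, hx0⟩ := hG.exists_fixed_point_of_prime_dvd_card_of_fixed_point Q hp
      (a := 0) (fun g => smul_zero (MonoidAlgebra.of (ZMod p) G g))
    have hfix : ∀ g : G, MonoidAlgebra.of (ZMod p) G g • x = x := hx
    let N := Submodule.span (MonoidAlgebra (ZMod p) G) {x}
    have hN : ∀ y ∈ N, ∀ g : G, (MonoidAlgebra.of (ZMod p) G g - 1) • y = 0 := by
      intro y hy g
      obtain ⟨r, rfl⟩ := Submodule.mem_span_singleton.mp hy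
      induction r using MonoidAlgebra.induction_on with
      | of h => rw [hfix, sub_smul, hfix, one_smul, sub_self]
      | add r s hr hs =>
        rw [add_smul, smul_add, hr (Submodule.smul_mem _ _ (Submodule.mem_span_singleton_self x)),
          hs (Submodule.smul_mem _ _ (Submodule.mem_span_singleton_self x)), add_zero]
      | smul c r hr =>
        rw [← mul_smul, mul_smul_comm, ← one_mul (_ * r), ← smul_mul_assoc, mul_smul, mul_smul,
          hr (Submodule.smul_mem _ _ (Submodule.mem_span_singleton_self x)), smul_zero]
    have hfin : Finite (Q ⧸ N) := Finite.of_surjective _ N.mkQ_surjective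
    have hlt : Nat.card (Q ⧸ N) < c := by
      have h1 := N.card_eq_card_quotient_mul_card
      have h2 : 1 < Nat.card N := by
        have : Nontrivial N := ⟨0, ⟨x, Submodule.mem_span_singleton_self x⟩,
          fun h => hx0 (congrArg Subtype.val h)⟩
        exact Finite.one_lt_card
      have h3 : 0 < Nat.card (Q ⧸ N) := Nat.card_pos
      rw [← hc, h1]
      nlinarith
    obtain ⟨n, hn⟩ := ih _ hlt (Q ⧸ N) rfl
    -- The last $n$ factors send `y` into `N`; the leading factor then kills it.
    refine ⟨n + 1, fun l hl y => ?_⟩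
    obtain ⟨g, l, rfl⟩ := List.exists_cons_of_length_eq_add_one hl
    rw [List.map_cons, List.prod_cons, mul_smul]
    refine hN _ ?_ g
    rw [← Submodule.Quotient.mk_eq_zero, Submodule.Quotient.mk_smul]
    exact hn l (by simpa using hl) _

/-! ### Word sums and the Magnus expansion -/

/-- The sum of `f` over all words of length `k`. -/
def wordSum {A R : Type*} [Fintype A] [AddCommMonoid R] : ℕ → (List A → R) → R
  | 0, f => f []
  | k + 1, f => ∑ b, wordSum k fun v => f (b :: v)

section WordSum

variable {A R : Type*} [Fintype A]

theorem wordSum_add [AddCommMonoid R] (k : ℕ) (f g : List A → R) :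
    wordSum k (fun v => f v + g v) = wordSum k f + wordSum k g := by
  induction k generalizing f g with
  | zero => rfl
  | succ k ih => simp only [wordSum, ih, Finset.sum_add_distrib]

theorem wordSum_zero [AddCommMonoid R] (k : ℕ) : wordSum k (fun _ : List A => (0 : R)) = 0 := by
  induction k with
  | zero => rfl
  | succ k ih => simp only [wordSum, ih, Finset.sum_const_zero]

theorem wordSum_mul [Semiring R] (k : ℕ) (f : List A → R) (x : R) :
    wordSum k (fun v => f v * x) = wordSum k f * x := by
  induction k generalizing f with
  | zero => rfl
  | succ k ih => simp only [wordSum, ih, Finset.sum_mul]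

theorem wordSum_congr [AddCommMonoid R] {k : ℕ} {f g : List A → R}
    (h : ∀ v, v.length = k → f v = g v) : wordSum k f = wordSum k g := by
  induction k generalizing f g with
  | zero => exact h [] rfl
  | succ k ih => exact Finset.sum_congr rfl fun b _ => ih fun v hv => h _ (by simp [hv])

end WordSum

section Magnus

variable {A : Type*} [DecidableEq A] {R : Type*} [Ring R]

/-- The number of occurrences of `v` as a subword of `u`, as an element of `R`; both words are
given by their reversals. -/
noncomputable def binomialRev (R : Type*) [Ring R] (u v : List A) : R :=
  ((qBinomialRev u v).eval 1 : ℕ)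

theorem binomialRev_nil_right (u : List A) : binomialRev R u [] = 1 := by
  cases u <;> simp [binomialRev, qBinomialRev]

theorem binomialRev_nil_cons (b : A) (v : List A) : binomialRev R [] (b :: v) = 0 := by
  simp [binomialRev, qBinomialRev]

theorem binomialRev_cons_cons (a b : A) (u v : List A) :
    binomialRev R (a :: u) (b :: v) =
      binomialRev R u (b :: v) + if a = b then binomialRev R u v else 0 := by
  rw [binomialRev, qBinomialRev]
  split_ifs <;> simp [binomialRev]

variable [Fintype A]

/-- The homogeneous part of degree `k` of the Magnus expansion of the word with reversal `u`. -/
noncomputable def magnusPart (x : A → R) (k : ℕ) (u : List A) : R :=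
  wordSum k fun v => binomialRev R u v * (v.reverse.map x).prod

theorem magnusPart_zero (x : A → R) (u : List A) : magnusPart x 0 u = 1 := by
  simp [magnusPart, wordSum, binomialRev_nil_right]

theorem magnusPart_succ_nil (x : A → R) (k : ℕ) : magnusPart x (k + 1) [] = 0 := by
  simp [magnusPart, wordSum, binomialRev_nil_cons, wordSum_zero]

/-- Occurrences of a subword either avoid the last letter `a` of the word or end with it; the latter
contribute the right factor `x a`. -/
theorem magnusPart_succ_cons (x : A → R) (k : ℕ) (a : A) (u : List A) :
    magnusPart x (k + 1) (a :: u) = magnusPart x (k + 1) u + magnusPart x k u * x a := by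
  simp only [magnusPart, wordSum, binomialRev_cons_cons, add_mul, wordSum_add,
    Finset.sum_add_distrib]
  congr 1
  rw [Finset.sum_eq_single a]
  · simp [← wordSum_mul, mul_assoc]
  · intro b _ hb
    simp [hb.symm, wordSum_zero]
  · simp

theorem prod_eq_sum_magnusPart (x : A → R) {n : ℕ}
    (hn : ∀ v : List A, v.length = n → (v.map x).prod = 0) (u : List A) :
    (u.reverse.map fun a => 1 + x a).prod = ∑ k ∈ Finset.range n, magnusPart x k u := by
  have hzero : ∀ u, magnusPart x n u = 0 := fun u => by
    rw [← wordSum_zero (A := A) n]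
    exact wordSum_congr fun v hv => by rw [hn _ (by simpa using hv), mul_zero]
  -- Degree $n$ is included although it vanishes, so that the shift of degree by one in the
  -- induction stays in range.
  have key : ∀ u, (u.reverse.map fun a => 1 + x a).prod =
      ∑ k ∈ Finset.range (n + 1), magnusPart x k u := by
    intro u
    induction u with
    | nil => simp [Finset.sum_range_succ', magnusPart_succ_nil, magnusPart_zero]
    | cons a u ih =>
      rw [List.reverse_cons, List.map_append, List.prod_append, ih,
        Finset.sum_range_succ' (fun k => magnusPart x k (a :: u))]
      simp only [magnusPart_succ_cons, Finset.sum_add_distrib, ← Finset.sum_mul]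
      have h : ∑ k ∈ Finset.range (n + 1), magnusPart x k u =
          ∑ k ∈ Finset.range n, magnusPart x k u := by
        rw [Finset.sum_range_succ, hzero, add_zero]
      have h' : ∑ k ∈ Finset.range (n + 1), magnusPart x k u =
        ∑ k ∈ Finset.range n, magnusPart x (k + 1) u + 1 := by
        rw [Finset.sum_range_succ', magnusPart_zero]
      simp only [List.map_cons, List.map_nil, List.prod_singleton, mul_add, mul_one,
        magnusPart_zero]
      rw [← h, h']
      abel
  rw [key, Finset.sum_range_succ, hzero, add_zero]

theorem prod_eq_prod_of_binomialRev_eq (x : A → R) {n : ℕ}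
    (hn : ∀ v : List A, v.length = n → (v.map x).prod = 0) {u w : List A}
    (h : ∀ v : List A, v.length < n → binomialRev R u v = binomialRev R w v) :
    (u.reverse.map fun a => 1 + x a).prod = (w.reverse.map fun a => 1 + x a).prod := by
  rw [prod_eq_sum_magnusPart x hn, prod_eq_sum_magnusPart x hn]
  refine Finset.sum_congr rfl fun k hk => wordSum_congr fun v hv => ?_
  rw [h v (hv.trans_lt (Finset.mem_range.mp hk))]

end Magnus

/-! ### Finite saturation and the main equivalence -/

/-- The hypothesis makes `L` a union of classes of the finite partition cut out by `F`. Inductively,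
cut `L` along one `K` and saturate each half for the remaining languages; intersecting again with
`K` or `Kᶜ` recovers that half. -/
theorem mem_booleanSubalgebra_of_saturated {A : Type*} (B : BooleanSubalgebra (Language A))
    {F : Set (Language A)} (hfin : F.Finite) (hF : F ⊆ B) (L : Language A)
    (hL : ∀ u w : List A, (∀ K ∈ F, u ∈ K ↔ w ∈ K) → u ∈ L → w ∈ L) : L ∈ B := by
  induction F, hfin using Set.Finite.induction_on generalizing L with
  | empty =>
    by_cases h : ∃ u, u ∈ L
    · obtain ⟨u, hu⟩ := h
      have : L = ⊤ := eq_top_iff.mpr fun w _ => hL u w (by simp) hu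
      rw [this]
      exact B.top_mem
    · have : L = ⊥ := eq_bot_iff.mpr fun w hw => h ⟨w, hw⟩
      rw [this]
      exact B.bot_mem
  | @insert K F hK hfin ih =>
    let sat : Language A → Language A := fun P =>
      {w : List A | ∃ u, u ∈ P ∧ ∀ K ∈ F, u ∈ K ↔ w ∈ K}
    have hsat : ∀ P, sat P ∈ B := fun P => by
      refine ih ((Set.subset_insert _ _).trans hF) _ ?_
      rintro u w huw ⟨t, ht, htu⟩
      exact ⟨t, ht, fun J hJ => (htu J hJ).trans (huw J hJ)⟩
    have hKB : K ∈ B := hF (Set.mem_insert _ _)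
    have : L = K ⊓ sat (L ⊓ K) ⊔ Kᶜ ⊓ sat (L ⊓ Kᶜ) := by
      apply le_antisymm
      · intro u hu
        by_cases h : u ∈ K
        · exact Or.inl ⟨h, u, ⟨hu, h⟩, fun _ _ => Iff.rfl⟩
        · exact Or.inr ⟨h, u, ⟨hu, h⟩, fun _ _ => Iff.rfl⟩
      · rintro w (⟨hw, u, ⟨hu, huK⟩, h⟩ | ⟨hw, u, ⟨hu, huK⟩, h⟩)
        · exact hL u w (Set.forall_mem_insert.mpr ⟨iff_of_true huK hw, h⟩) hu
        · exact hL u w (Set.forall_mem_insert.mpr ⟨iff_of_false huK hw, h⟩) hu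
    rw [this]
    exact B.sup_mem (B.inf_mem hKB (hsat _)) (B.inf_mem (B.compl_mem hKB) (hsat _))

theorem finite_setOf_degree_lt {K : Type*} [Field K] [Finite K] (n : WithBot ℕ) :
    {r : K[X] | r.degree < n}.Finite := by
  induction n with
  | bot => simp
  | coe n =>
    have : Finite (degreeLT K n) := Finite.of_equiv _ (degreeLTEquiv K n).toEquiv.symm
    have h : {r : K[X] | r.degree < (n : WithBot ℕ)} = degreeLT K n := by
      ext r
      exact mem_degreeLT.symm
    exact h ▸ (Set.toFinite (degreeLT K n : Set K[X]))

/-- Equal binomials give equal truncated Magnus expansions, hence equal images in $\mathbb{F}_p[G]$,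
where $G$ embeds. -/
theorem IsPGroupLanguage.exists_length_bound {A : Type*} [Finite A] [DecidableEq A] {p : ℕ}
    [Fact p.Prime] {L : Language A} (hL : IsPGroupLanguage p L) :
    ∃ n : ℕ, ∀ u w : List A, (∀ v : List A, v.length < n →
      (((qBinomial u v).eval 1 : ℕ) : ZMod p) = ((qBinomial w v).eval 1 : ℕ)) → u ∈ L → w ∈ L := by
  obtain ⟨G, hG, hfin, hp, μ, S, hS⟩ := hL
  have := Fintype.ofFinite A
  let R := MonoidAlgebra (ZMod p) G
  have hR : Finite R := Finite.of_injective (fun f : R => (f.coeff : G → ZMod p))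
    (DFunLike.coe_injective.comp MonoidAlgebra.coeff_injective)
  obtain ⟨n, hn⟩ := exists_prod_of_sub_one_smul_eq_zero hp R
  refine ⟨n, fun u w h hu => ?_⟩
  let x : A → R := fun a => MonoidAlgebra.of (ZMod p) G (μ (FreeMonoid.of a)) - 1
  have hx : ∀ v : List A, v.length = n → (v.map x).prod = 0 := fun v hv => by
    simpa [x, Function.comp_def] using hn (v.map fun a => μ (FreeMonoid.of a)) (by simpa) 1
  have hprod : ∀ v : List A, (v.map fun a => 1 + x a).prod =
      MonoidAlgebra.of (ZMod p) G (μ (FreeMonoid.ofList v)) := by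
    intro v
    induction v with
    | nil => exact ((congrArg _ (map_one μ)).trans (map_one _)).symm
    | cons a v ih =>
      rw [List.map_cons, List.prod_cons, ih, FreeMonoid.ofList_cons, map_mul, map_mul,
        add_sub_cancel]
  have key := prod_eq_prod_of_binomialRev_eq x hx (u := u.reverse) (w := w.reverse) fun v hv => by
    have := congrArg (algebraMap (ZMod p) R) (h v.reverse (by simpa using hv))
    simpa [qBinomial, binomialRev] using this
  rw [List.reverse_reverse, List.reverse_reverse, hprod, hprod] at key
  rw [hS, ← MonoidAlgebra.of_injective key, ← hS]
  exact hu

theorem eval_qBinomial_eq_of_mem_qBinomialLanguage {A : Type*} [DecidableEq A] {p : ℕ}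
    {u w v : List A} {r M : (ZMod p)[X]} (hM : M.eval 1 = 0) (hu : u ∈ qBinomialLanguage v r M)
    (hw : w ∈ qBinomialLanguage v r M) :
    (((qBinomial u v).eval 1 : ℕ) : ZMod p) = ((qBinomial w v).eval 1 : ℕ) := by
  have key : ∀ t ∈ qBinomialLanguage v r M,
      (((qBinomial t v).eval 1 : ℕ) : ZMod p) = r.eval 1 := by
    intro t ht
    obtain ⟨f, hf⟩ := ht
    have h := congrArg (eval 1) hf
    rw [eval_mul, hM, zero_mul, eval_sub, sub_eq_zero, eval_one_map] at h
    exact h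
  rw [key u hu, key w hw]

/-- Boolean combinations are the members of the Boolean subalgebra (closed under finite unions,
finite intersections and complements) generated by the languages `L_{v,R,M}`, `deg R < deg M`. -/
theorem mainTheorem10 {A : Type*} [Finite A] [DecidableEq A] (p : ℕ) [Fact p.Prime]
    (d : ℕ) (hd : 1 ≤ d) (a : ZMod p) (ha : a ≠ 0) (M : (ZMod p)[X])
    (hM : M = C a * (X - 1) ^ d) (L : Language A) :
    IsPGroupLanguage p L ↔
      L ∈ BooleanSubalgebra.closure
        {K : Language A | ∃ (v : List A) (R : (ZMod p)[X]),
          R.degree < M.degree ∧ K = qBinomialLanguage v R M} := by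
  have hM1 : M.eval 1 = 0 := by
    simp [hM, Nat.one_le_iff_ne_zero.mp hd]
  have hM0 : M ≠ 0 := by
    rw [hM]
    exact mul_ne_zero (C_ne_zero.mpr ha) (pow_ne_zero _ (X_sub_C_ne_zero 1))
  constructor
  · intro hL
    obtain ⟨n, hn⟩ := hL.exists_length_bound
    refine mem_booleanSubalgebra_of_saturated _
      (F := Set.image2 (fun v R => qBinomialLanguage v R M) {v : List A | v.length < n}
        {R | R.degree < M.degree})
      ((List.finite_length_lt A n).image2 _ (finite_setOf_degree_lt _)) ?_ L fun u w h => hn u w ?_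
    · rintro _ ⟨v, -, R, hR, rfl⟩
      exact BooleanSubalgebra.subset_closure ⟨v, R, hR, rfl⟩
    · intro v hv
      let f := (qBinomial u v).map (Nat.castRingHom (ZMod p))
      -- The word `u` lies in the language of its own residue; `h` then places `w` there too.
      have hu : u ∈ qBinomialLanguage v (f % M) M :=
        ⟨f / M, by rw [sub_eq_iff_eq_add, EuclideanDomain.div_add_mod]⟩
      exact eval_qBinomial_eq_of_mem_qBinomialLanguage hM1 hu
        ((h _ ⟨v, hv, f % M, degree_mod_lt f hM0, rfl⟩).mp hu)
  · intro hL
    induction hL using BooleanSubalgebra.closure_bot_sup_induction with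
    | mem K hK =>
      obtain ⟨v, R, -, rfl⟩ := hK
      rw [hM]
      exact isPGroupLanguage_qBinomialLanguage p d hd a ha v R
    | bot => exact isPGroupLanguage_bot
    | sup K _ K' _ h h' => exact h.sup h'
    | compl K _ h => exact h.compl
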